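/- Let $I=[0,1]$ with Lebesgue measure, and let $f:I\to I$ be a function such that almost every $x\in I$ has infinite orbit $\{x,f(x),f^2(x),\dots\}$; let $I_{ap}$ be the set of points with infinite orbit. The order pattern $\mathrm{ord}(y_1,\dots,y_m)$ of distinct elements of a totally ordered set is the permutation $\sigma\in S_m$ with $y_i<y_j\iff\sigma(i)<\sigma(j)$. For $m\ge 1$ let $\boldsymbol\sigma_m(f)=\{\mathrm{ord}(x,f(x),\dots,f^{m-1}(x)) : x\in I_{ap}\}\subseteq S_m$. For $n\ge1$ let $G_n$ be the digraph with vertex set $S_n$ and edge set $S_{n+1}$, in which the edge $\tau\in S_{n+1}$ leads from $\mathrm{ord}(\tau(1),\dots,\tau(n))$ to $\mathrm{ord}(\tau(2),\dots,\tau(n+1))$. A path of $G_{n+1}$ of length $\ell$ with vertices $v_0,\dots,v_\ell\in S_{n+1}$ projects to the path of $G_n$ of length $\ell+1$ with successive edges $v_0,\dots,v_\ell$; for $m\ge n$ let $\pi_{m,n}$ be the iterated projection from paths of $G_m$ to paths of $G_n$. A permutation $\sigma\in S_m$ is regarded as a path of length $0$ in $G_m$, so that $\pi_{m,n}(\sigma)$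 is a path of length $m-n$ in $G_n$. The function $f$ has finite exclusion type if for some $n\ge1$ there is a subgraph $H\subseteq G_n$ such that for all $m\ge n$ $$\boldsymbol\sigma_m(f)=\{\sigma\in S_m : \pi_{m,n}(\sigma)\text{ is a path in } H\}.$$ Suppose that $f$ is piecewise continuous and piecewise monotone (that is, $I$ is a union of finitely many, possibly degenerate, intervals on each of which $f$ is continuous, and also a union of finitely many such intervals on each of which $f$ is nondecreasing or nonincreasing), and that at least one of the following holds: 1. $f$ is ergodic on a subinterval of $I$: there is a nondegenerate interval $J\subseteq I$ such that $f$ preserves Lebesgue measure restricted to $J$ and is ergodic with respect to it; 2. for every $N$ there is a periodic point $x$ of $f$ of least period at least $N$ such that $f$ is continuous at every point of the orbit of $x$. Then $f$ does not have finite exclusion type. -/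

import Mathlib

open MeasureTheory

namespace OrderPattern

/-! ### Order patterns -/

/-- The symmetric group on `n` letters (indexed from `0`). -/
abbrev S (n : ℕ) : Type := Equiv.Perm (Fin n)

/-- The order pattern of a tuple of distinct elements of a linear order: the permutation ranking the
entries in increasing order, i.e. the unique `σ` with `g i < g j ↔ σ i < σ j`.
(`Tuple.sort g` is the permutation `τ` for which `g ∘ τ` is increasing.) -/
def order {Y : Type*} [LinearOrder Y] {n : ℕ} (g : Fin n → Y) : S n := (Tuple.sort g)⁻¹

theorem order_lt_order_iff {Y : Type*} [LinearOrder Y] {n : ℕ} {g : Fin n → Y}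
    (hg : Function.Injective g) (i j : Fin n) : order g i < order g j ↔ g i < g j := by
  have hm : StrictMono (g ∘ Tuple.sort g) :=
    (Tuple.monotone_sort g).strictMono_of_injective (hg.comp (Tuple.sort g).injective)
  have h := hm.lt_iff_lt (a := order g i) (b := order g j)
  simpa [order] using h.symm

theorem eq_of_lt_iff_lt {n : ℕ} {σ τ : S n} (h : ∀ i j, σ i < σ j ↔ τ i < τ j) : σ = τ := by
  have hm : StrictMono (σ.symm.trans τ) := by
    intro a b hab
    have := (h (σ.symm a) (σ.symm b)).1 (by simpa using hab)
    simpa using this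
  let e : Fin n ≃o Fin n := hm.orderIsoOfSurjective _ (σ.symm.trans τ).surjective
  have he : e = OrderIso.refl _ := Subsingleton.elim _ _
  ext i
  have h1 : e (σ i) = τ i := by simp [e]
  rw [← h1, he]
  rfl

theorem eq_order {Y : Type*} [LinearOrder Y] {n : ℕ} {g : Fin n → Y}
    (hg : Function.Injective g) {σ : S n} (h : ∀ i j, g i < g j ↔ σ i < σ j) : σ = order g :=
  eq_of_lt_iff_lt fun i j => (h i j).symm.trans (order_lt_order_iff hg i j).symm

theorem order_order_comp {Y : Type*} [LinearOrder Y] {n m : ℕ} {g : Fin n → Y}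
    (hg : Function.Injective g) {e : Fin m → Fin n} (he : Function.Injective e) :
    order (order g ∘ e) = order (g ∘ e) := by
  refine eq_order (hg.comp he) fun i j => ?_
  rw [order_lt_order_iff ((order g).injective.comp he)]
  exact (order_lt_order_iff hg (e i) (e j)).symm

/-- `ρ σ`: the order pattern of the restriction of `σ` to all but the last letter. -/
def rho {n : ℕ} (σ : S (n + 1)) : S n := order (σ ∘ Fin.castSucc)

/-- `ρ' σ`: the order pattern of the restriction of `σ` to all but the first letter. -/
def rho' {n : ℕ} (σ : S (n + 1)) : S n := order (σ ∘ Fin.succ)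

theorem rho'_rho {n : ℕ} (σ : S (n + 2)) : rho' (rho σ) = rho (rho' σ) := by
  unfold rho rho'
  rw [order_order_comp (σ.injective.comp (Fin.castSucc_injective _)) (Fin.succ_injective _),
    order_order_comp (σ.injective.comp (Fin.succ_injective _)) (Fin.castSucc_injective _)]
  rfl

/-! ### Digraphs and paths -/

/-- A digraph `(VG, EG, h, t)`, possibly with loops and multiple edges. -/
structure MultiDigraph where
  V : Type
  E : Type
  h : E → V
  t : E → V

/-- A subgraph: a set of vertices and a set of edges whose endpoints are among those vertices. -/
structure Subgraph (G : MultiDigraph) where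
  verts : Set G.V
  edges : Set G.E
  h_mem : ∀ e ∈ edges, G.h e ∈ verts
  t_mem : ∀ e ∈ edges, G.t e ∈ verts

/-- A finite path `(v 0, e 0, v 1, e 1, …, v length)`; the edge `e i` leads from `v i = h (e i)`
to `v (i + 1) = t (e i)`. -/
structure FinPath (G : MultiDigraph) where
  length : ℕ
  v : Fin (length + 1) → G.V
  e : Fin length → G.E
  h_e : ∀ i, G.h (e i) = v i.castSucc
  t_e : ∀ i, G.t (e i) = v i.succ

/-- The path of length zero at a vertex. -/
def FinPath.nil {G : MultiDigraph} (a : G.V) : FinPath G where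
  length := 0
  v := fun _ => a
  e := Fin.elim0
  h_e := fun i => i.elim0
  t_e := fun i => i.elim0

/-- The set of paths of length `ℓ` of a subgraph `H` of `G`, as paths in `G`. -/
def Subgraph.paths {G : MultiDigraph} (H : Subgraph G) (ℓ : ℕ) : Set (FinPath G) :=
  {p | p.length = ℓ ∧ (∀ i, p.v i ∈ H.verts) ∧ ∀ i, p.e i ∈ H.edges}

/-- The permutation digraph `G_n = (S_n, S_{n+1}, ρ, ρ')`. -/
def permDigraph (n : ℕ) : MultiDigraph where
  V := S n
  E := S (n + 1)
  h := rho
  t := rho'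

/-- The projection of a path of `G_{n+1}` to `G_n`: the concatenation of the one-edge paths
`(ρ (v i), v i, ρ' (v i))`, where `v i` runs through the vertices of the given path. -/
def projOne {n : ℕ} (p : FinPath (permDigraph (n + 1))) : FinPath (permDigraph n) where
  length := p.length + 1
  v := Fin.cases (rho (p.v 0)) fun i => rho' (p.v i)
  e := p.v
  h_e := by
    intro i
    induction i using Fin.cases with
    | zero => rfl
    | succ i =>
      have h1 : rho (p.e i) = p.v i.castSucc := p.h_e i
      have h2 : rho' (p.e i) = p.v i.succ := p.t_e i
      change rho (p.v i.succ) = rho' (p.v i.castSucc)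
      rw [← h1, ← h2]
      exact (rho'_rho _).symm
  t_e := fun _ => rfl

/-- The iterated projection `π_{n+k,n}` from paths of `G_{n+k}` to paths of `G_n`. -/
def proj {n : ℕ} : (k : ℕ) → FinPath (permDigraph (n + k)) → FinPath (permDigraph n)
  | 0, p => p
  | k + 1, p => proj k (projOne p)

/-! ### Self-maps of the unit interval -/

/-- The points with infinite forward orbit. -/
def aperiodicPts (f : unitInterval → unitInterval) : Set unitInterval := {x | (Set.range fun k : ℕ => f^[k] x).Infinite}

/-- Almost every point (with respect to Lebesgue measure) has infinite orbit. -/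
def AlmostAperiodic (f : unitInterval → unitInterval) : Prop := ∀ᵐ x ∂(volume : Measure unitInterval), x ∈ aperiodicPts f

/-- The set of permutations of length `n` realized by `f`, i.e. the order patterns of
`(x, f x, …, f^{n-1} x)` for `x` with infinite orbit. -/
def patterns (f : unitInterval → unitInterval) (n : ℕ) : Set (S n) :=
  (fun x : unitInterval => order fun i : Fin n => f^[(i : ℕ)] x) '' aperiodicPts f

/-- `f` has exclusion type `n`: for some subgraph `H` of `G_n` and all `m = n + k ≥ n`, the patterns
of length `m` realized by `f` are exactly the `σ ∈ S_m` (seen as paths of length `0` in `G_m`)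
whose projection to `G_n` is a path (of length `m - n = k`) in `H`. -/
def HasExclusionType (f : unitInterval → unitInterval) (n : ℕ) : Prop :=
  ∃ H : Subgraph (permDigraph n), ∀ k : ℕ,
    patterns f (n + k) =
      (fun σ : S (n + k) => proj k (FinPath.nil (G := permDigraph (n + k)) σ)) ⁻¹' H.paths k

/-- `f` has exclusion type `n` for some positive integer `n`. -/
def HasFiniteExclusionType (f : unitInterval → unitInterval) : Prop := ∃ n : ℕ, 1 ≤ n ∧ HasExclusionType f n

/-- `[0,1]` is a union of finitely many intervals (possibly degenerate) on each of which the
restriction of `f` is continuous. -/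
def PiecewiseContinuous (f : unitInterval → unitInterval) : Prop :=
  ∃ P : Finset (Set unitInterval), (⋃ J ∈ P, J) = Set.univ ∧ ∀ J ∈ P, J.OrdConnected ∧ ContinuousOn f J

/-- `[0,1]` is a union of finitely many intervals (possibly degenerate) on each of which `f` is
monotone (nondecreasing or nonincreasing). -/
def PiecewiseMonotone (f : unitInterval → unitInterval) : Prop :=
  ∃ P : Finset (Set unitInterval), (⋃ J ∈ P, J) = Set.univ ∧
    ∀ J ∈ P, J.OrdConnected ∧ (MonotoneOn f J ∨ AntitoneOn f J)

/-- For some nondegenerate interval `J`, `f` preserves Lebesgue measure on `J` (in particular `f`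
maps almost every point of `J` into `J`) and is ergodic with respect to it. -/
def ErgodicOnSubinterval (f : unitInterval → unitInterval) : Prop :=
  ∃ J : Set unitInterval, J.OrdConnected ∧ J.Nontrivial ∧ Ergodic f ((volume : Measure unitInterval).restrict J)

/-- `f` has periodic orbits of arbitrarily large cardinality at all of whose points `f` is
continuous. -/
def HasLargeContinuousPeriodicOrbits (f : unitInterval → unitInterval) : Prop :=
  ∀ N : ℕ, ∃ x : unitInterval, x ∈ Function.periodicPts f ∧ N ≤ Function.minimalPeriod f x ∧
    ∀ k : ℕ, ContinuousAt f (f^[k] x)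

end OrderPattern

namespace OrderPattern

/-! ### Windows of a permutation and paths in a subgraph -/

/-! Exclusion type `n` makes membership in the realized patterns a local condition: a permutation of
length greater than `n` is realized as soon as all its windows of `n + 1` consecutive letters are
(`HasExclusionType.mem_patterns`). Now take a sequence of period `p ≥ n + 1`, distinct within a
period, all of whose windows of length `n + 1` are realized. No such window contains two equal
entries, so ties between positions congruent modulo `p` may be broken arbitrarily over a long
stretch, and the result is still realized, by some `y`. Breaking them so that the points `f^[p * a]
y` increase with `a` while their images oscillate contradicts piecewise monotonicity
(`not_hasExclusionType_of_periodic`).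

It remains to find such sequences. A long periodic orbit of continuity points is one, its windows
being realized by nearby points with infinite orbit. In the measure-preserving case, Poincaré
recurrence gives a point that returns close to itself after a long time, and a segment of its orbit
is closed up into a periodic sequence (`not_hasExclusionType_of_recurrent`). -/

theorem order_perm {n : ℕ} (σ : S n) : order σ = σ :=
  (eq_order σ.injective fun _ _ => Iff.rfl).symm

/-- The order pattern of the `n` consecutive letters of `σ` starting at position `i`. -/
def window {m : ℕ} (σ : S m) (n i : ℕ) (h : i + n ≤ m) : S n :=
  order fun j : Fin n => σ ⟨i + j, by omega⟩

theorem window_full {n : ℕ} (σ : S n) (h : 0 + n ≤ n) : window σ n 0 h = σ := by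
  simp [window, order_perm]

theorem window_order {Y : Type*} [LinearOrder Y] {m : ℕ} {g : Fin m → Y}
    (hg : Function.Injective g) (n i : ℕ) (h : i + n ≤ m) :
    window (order g) n i h = order fun j : Fin n => g ⟨i + j, by omega⟩ := by
  refine order_order_comp hg (e := fun j : Fin n => (⟨i + j, by omega⟩ : Fin m)) ?_
  intro a b hab
  simp only [Fin.mk.injEq] at hab
  omega

theorem window_rho {m : ℕ} (σ : S (m + 1)) (n i : ℕ) (h : i + n ≤ m) :
    window (rho σ) n i h = window σ n i (by omega) :=
  window_order (σ.injective.comp (Fin.castSucc_injective _)) n i h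

theorem window_rho' {m : ℕ} (σ : S (m + 1)) (n i : ℕ) (h : i + n ≤ m) :
    window (rho' σ) n i h = window σ n (i + 1) (by omega) := by
  rw [rho', window_order (σ.injective.comp (Fin.succ_injective _)) n i h]
  unfold window
  congr 1
  funext j
  simp only [Function.comp_apply]
  congr 1
  ext
  simp only [Fin.val_succ]
  omega

/-- Iterated projection only cuts vertices into shorter windows, so the edges finally obtained in
`G_n` are windows of length `n + 1` of the original vertices. The case of zero projections is left
out, since there a path need not have edges. -/
theorem proj_mem_paths {n : ℕ} (H : Subgraph (permDigraph n)) (k : ℕ)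
    (p : FinPath (permDigraph (n + (k + 1))))
    (hp : ∀ a i (h : i + (n + 1) ≤ n + (k + 1)),
      window (m := n + (k + 1)) (p.v a) (n + 1) i h ∈ H.edges) :
    proj (k + 1) p ∈ H.paths (p.length + (k + 1)) := by
  induction k with
  | zero =>
    have hv : ∀ a, p.v a ∈ H.edges := fun a => by
      have := hp a 0 (by omega)
      rwa [show window (m := n + 1) (p.v a) (n + 1) 0 (by omega) = p.v a from
        window_full (n := n + 1) (p.v a) _] at this
    refine ⟨rfl, fun i => ?_, hv⟩
    induction i using Fin.cases with
    | zero => exact H.h_mem _ (hv 0)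
    | succ i => exact H.t_mem _ (hv i)
  | succ k ih =>
    have := ih (projOne p) fun a i h => by
      induction a using Fin.cases with
      | zero =>
        have h1 := hp 0 i (by omega)
        rwa [← window_rho (m := n + (k + 1)) (p.v 0) (n + 1) i h] at h1
      | succ a =>
        have h1 := hp a (i + 1) (by omega)
        rwa [← window_rho' (m := n + (k + 1)) (p.v a) (n + 1) i h] at h1
    rw [show p.length + (k + 1 + 1) = (projOne p).length + (k + 1) by
      simp only [projOne]; omega]
    exact this

theorem HasExclusionType.mem_patterns {f : unitInterval → unitInterval} {n : ℕ}
    (hf : HasExclusionType f n) {k : ℕ} (σ : S (n + (k + 1)))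
    (hσ : ∀ i (h : i + (n + 1) ≤ n + (k + 1)), window σ (n + 1) i h ∈ patterns f (n + 1)) :
    σ ∈ patterns f (n + (k + 1)) := by
  obtain ⟨H, hH⟩ := hf
  -- A realized pattern of length `n + 1` projects to a one-edge path whose edge is the pattern
  -- itself.
  have hedge : ∀ τ ∈ patterns f (n + 1), τ ∈ H.edges := fun τ hτ => by
    rw [hH 1] at hτ
    exact hτ.2.2 (0 : Fin 1)
  rw [hH (k + 1)]
  have := proj_mem_paths H k (FinPath.nil (G := permDigraph (n + (k + 1))) σ)
    fun _ i h => hedge _ (hσ i h)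
  rw [show (FinPath.nil (G := permDigraph (n + (k + 1))) σ).length = 0 from rfl,
    Nat.zero_add] at this
  exact this

/-! ### Aperiodic points -/

theorem iterate_injective {f : unitInterval → unitInterval} {x : unitInterval}
    (hx : x ∈ aperiodicPts f) : Function.Injective fun k : ℕ => f^[k] x := by
  have key : ∀ a d : ℕ, f^[a + (d + 1)] x ≠ f^[a] x := by
    intro a d h
    refine hx (((Finset.range (a + (d + 1))).image fun k => f^[k] x).finite_toSet.subset ?_)
    rintro _ ⟨k, rfl⟩
    simp only [Finset.coe_image, Finset.coe_range, Set.mem_image, Set.mem_Iio]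
    induction k using Nat.strong_induction_on with
    | _ k ih =>
      rcases lt_or_ge k (a + (d + 1)) with hk | hk
      · exact ⟨k, hk, rfl⟩
      · obtain ⟨l, hl, hl'⟩ := ih (k - (d + 1)) (by omega)
        -- Once a value recurs, times may be reduced by the period `d + 1`, so the orbit would be
        -- finite.
        refine ⟨l, hl, hl'.trans ?_⟩
        obtain ⟨e, rfl⟩ := Nat.exists_eq_add_of_le hk
        rw [show a + (d + 1) + e - (d + 1) = e + a by omega,
          show a + (d + 1) + e = e + (a + (d + 1)) by omega,
          Function.iterate_add_apply, Function.iterate_add_apply f e, h]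
  intro a b hab
  by_contra hne
  rcases lt_or_gt_of_ne hne with h | h
  · obtain ⟨d, rfl⟩ := Nat.exists_eq_add_of_lt h
    exact key a d (by simpa [add_assoc] using hab.symm)
  · obtain ⟨d, rfl⟩ := Nat.exists_eq_add_of_lt h
    exact key b d (by simpa [add_assoc] using hab)

theorem iterate_mem_aperiodicPts {f : unitInterval → unitInterval} {x : unitInterval}
    (hx : x ∈ aperiodicPts f) (a : ℕ) : f^[a] x ∈ aperiodicPts f := by
  have : Function.Injective fun k : ℕ => f^[k] (f^[a] x) := fun i j hij => by
    simp only [← Function.iterate_add_apply] at hij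
    have := iterate_injective hx hij
    omega
  exact Set.infinite_range_of_injective this

theorem order_mem_patterns {f : unitInterval → unitInterval} {x : unitInterval}
    (hx : x ∈ aperiodicPts f) {n : ℕ} {Y : Type*} [LinearOrder Y] {g : Fin n → Y}
    (h : ∀ i j : Fin n, f^[i] x < f^[j] x ↔ g i < g j) : order g ∈ patterns f n := by
  have hinj : Function.Injective fun i : Fin n => f^[(i : ℕ)] x :=
    (iterate_injective hx).comp Fin.val_injective
  have hg : Function.Injective g := fun i j hij => by
    by_contra hne
    rcases lt_or_gt_of_ne (hinj.ne hne) with h1 | h1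
    · exact absurd ((h i j).1 h1) (by simp [hij])
    · exact absurd ((h j i).1 h1) (by simp [hij])
  refine ⟨x, hx, ?_⟩
  exact (eq_order hinj fun i j => (h i j).trans (order_lt_order_iff hg i j).symm).symm

/-! ### Zigzags of piecewise monotone maps -/

/-- With more than twice as many points as pieces, some piece contains three of them. By convexity
it contains three with consecutive indices, across which `f` both rises and falls. -/
theorem PiecewiseMonotone.exists_zigzag_bound {f : unitInterval → unitInterval}
    (hf : PiecewiseMonotone f) : ∃ q : ℕ, ∀ x : ℕ → unitInterval,
      (∀ a b, a < b → b < q → x a < x b) →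
      ¬ ∀ a, a + 1 < q → if Even a then f (x (a + 1)) < f (x a) else f (x a) < f (x (a + 1)) := by
  obtain ⟨P, hP, hPJ⟩ := hf
  refine ⟨P.card * 2 + 1, fun x hx hzig => ?_⟩
  have hex : ∀ a, ∃ J ∈ P, x a ∈ J := fun a => by
    have : x a ∈ ⋃ J ∈ P, J := hP ▸ Set.mem_univ _
    simpa using this
  choose J hJP hJ using hex
  classical
  obtain ⟨K, hKP, hK⟩ := Finset.exists_lt_card_fiber_of_mul_lt_card_of_maps_to
    (s := Finset.range (P.card * 2 + 1)) (t := P) (f := J) (n := 2) (fun a _ => hJP a) (by simp)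
  set s := (Finset.range (P.card * 2 + 1)).filter fun a => J a = K with hs
  have hne : s.Nonempty := Finset.card_pos.1 (by omega)
  have hcard : s.card ≤ (Finset.Icc (s.min' hne) (s.max' hne)).card :=
    Finset.card_le_card fun a ha => Finset.mem_Icc.2 ⟨s.min'_le a ha, s.le_max' a ha⟩
  rw [Nat.card_Icc] at hcard
  have hmin := Finset.mem_filter.1 (s.min'_mem hne)
  have hmax := Finset.mem_filter.1 (s.max'_mem hne)
  set a := s.min' hne
  set b := s.max' hne
  have hb : b < P.card * 2 + 1 := Finset.mem_range.1 hmax.1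
  have hxa : x a ∈ K := hmin.2 ▸ hJ a
  have hxb : x b ∈ K := hmax.2 ▸ hJ b
  have hmono : ∀ c d, c ≤ d → d < P.card * 2 + 1 → x c ≤ x d := fun c d hcd hd => by
    rcases hcd.eq_or_lt with rfl | h
    · exact le_rfl
    · exact (hx c d h hd).le
  have hK' : ∀ c, a ≤ c → c ≤ b → x c ∈ K := fun c hac hcb =>
    (hPJ K hKP).1.out hxa hxb ⟨hmono _ _ hac (by omega), hmono _ _ hcb hb⟩
  have m0 := hK' a le_rfl (by omega)
  have m1 := hK' (a + 1) (by omega) (by omega)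
  have m2 := hK' (a + 1 + 1) (by omega) (by omega)
  have l1 := hmono a (a + 1) (by omega) (by omega)
  have l2 := hmono (a + 1) (a + 1 + 1) (by omega) (by omega)
  have z1 := hzig a (by omega)
  have z2 := hzig (a + 1) (by omega)
  rcases (hPJ K hKP).2 with h | h
  · have h1 := h m0 m1 l1
    have h2 := h m1 m2 l2
    by_cases he : Even a
    · rw [if_pos he] at z1
      exact absurd z1 h1.not_gt
    · rw [if_pos (by simpa [Nat.even_add_one] using he)] at z2
      exact absurd z2 h2.not_gt
  · have h1 := h m0 m1 l1
    have h2 := h m1 m2 l2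
    by_cases he : Even a
    · rw [if_neg (by simpa [Nat.even_add_one] using he)] at z2
      exact absurd z2 h2.not_gt
    · rw [if_neg he] at z1
      exact absurd z1 h1.not_gt

/-! ### Periodic sequences all of whose windows are realized -/

/-- A tie-breaking rule for positions in the same residue class modulo `p`: increasing in time,
except for the class of `1`, where it alternates. -/
def tieBreak (p i : ℕ) : ℤ := if i % p = 1 then (-1) ^ (i / p) * (i / p : ℕ) else (i / p : ℕ)

theorem eq_of_tieBreak_eq {p i j : ℕ} (hmod : i % p = j % p)
    (h : tieBreak p i = tieBreak p j) : i = j := by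
  have hdiv : i / p = j / p := by
    unfold tieBreak at h
    rw [hmod] at h
    split_ifs at h
    · have := congrArg Int.natAbs h
      rwa [Int.natAbs_mul, Int.natAbs_mul, Int.natAbs_pow, Int.natAbs_pow, Int.natAbs_neg,
        Int.natAbs_one, one_pow, one_pow, one_mul, one_mul, Int.natAbs_natCast,
        Int.natAbs_natCast] at this
    · exact_mod_cast h
  rw [← Nat.div_add_mod i p, ← Nat.div_add_mod j p, hdiv, hmod]

theorem tieBreak_mul {p : ℕ} (hp : 2 ≤ p) (a : ℕ) : tieBreak p (p * a) = a := by
  simp [tieBreak, Nat.mul_div_cancel_left a (by omega : 0 < p)]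

theorem tieBreak_mul_add_one {p : ℕ} (hp : 2 ≤ p) (a : ℕ) :
    tieBreak p (p * a + 1) = (-1) ^ a * a := by
  have h1 : (p * a + 1) % p = 1 := by
    rw [Nat.mul_add_mod, Nat.mod_eq_of_lt (by omega)]
  have h2 : (p * a + 1) / p = a := by
    rw [Nat.mul_add_div (by omega), Nat.div_eq_of_lt (by omega : 1 < p), add_zero]
  rw [tieBreak, if_pos h1, h2]

/-- The sequence `z` is refined to an injective one by lexicographic comparison with `tieBreak`. -/
theorem not_hasExclusionType_of_periodic {f : unitInterval → unitInterval}
    (hmono : PiecewiseMonotone f) {n p : ℕ} (hn : 1 ≤ n) (hp : n + 1 ≤ p)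
    {Y : Type*} [LinearOrder Y] (z : ℕ → Y) (hz : ∀ i j, z i = z j ↔ i % p = j % p)
    (hw : ∀ i, order (fun j : Fin (n + 1) => z (i + j)) ∈ patterns f (n + 1)) :
    ¬ HasExclusionType f n := by
  intro hf
  obtain ⟨q, hq⟩ := hmono.exists_zigzag_bound
  -- This separates the residue classes of `0` and `1`, which follow different tie-breaking rules.
  have hp2 : 2 ≤ p := by omega
  let G : ℕ → Y ×ₗ ℤ := fun i => toLex (z i, tieBreak p i)
  have hlt : ∀ i j, G i < G j ↔ z i < z j ∨ z i = z j ∧ tieBreak p i < tieBreak p j := fun i j =>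
    Prod.Lex.toLex_lt_toLex
  have hG : Function.Injective G := fun i j hij => by
    have h := Prod.ext_iff.1 (toLex.injective hij)
    exact eq_of_tieBreak_eq ((hz i j).1 h.1) h.2
  have hg : Function.Injective fun i : Fin (n + (p * q + 1)) => G i := hG.comp Fin.val_injective
  have hzw : ∀ i, Function.Injective fun j : Fin (n + 1) => z (i + j) := fun i j k hjk => by
    have h := (hz _ _).1 hjk
    have h' : (j : ℕ) ≡ k [MOD p] := Nat.ModEq.add_left_cancel' i h
    have := h'.eq_of_lt_of_lt (by omega) (by omega)
    exact Fin.ext this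
  -- Inside a window of length `n + 1 ≤ p` the values of `z` are distinct, so the tie-break plays no
  -- role there.
  obtain ⟨y, hy, hσ⟩ := hf.mem_patterns (k := p * q) (order fun i : Fin _ => G i) fun i h => by
    rw [window_order hg]
    convert hw i using 1
    refine eq_of_lt_iff_lt fun j k => ?_
    have hGw : Function.Injective fun j : Fin (n + 1) => G (i + j) := fun a b hab =>
      Fin.ext (Nat.add_left_cancel (hG hab))
    rw [order_lt_order_iff (hzw i)]
    refine (order_lt_order_iff hGw j k).trans ?_
    rw [hlt]
    constructor
    · rintro (h | ⟨h, h'⟩)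
      · exact h
      · rw [hzw i h] at h'
        exact absurd h' (lt_irrefl _)
    · exact Or.inl
  have hcmp : ∀ i j, i < p * q + 1 → j < p * q + 1 → (f^[i] y < f^[j] y ↔ G i < G j) :=
    fun i j hi hj => by
      have hinj : Function.Injective fun i : Fin (n + (p * q + 1)) => f^[(i : ℕ)] y :=
        (iterate_injective hy).comp Fin.val_injective
      have h1 := order_lt_order_iff hinj ⟨i, by omega⟩ ⟨j, by omega⟩
      have h2 := order_lt_order_iff hg ⟨i, by omega⟩ ⟨j, by omega⟩
      rw [← hσ] at h2
      exact h1.symm.trans h2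
  have hbound : ∀ a, a < q → p * a + 1 < p * q + 1 := fun a ha => by
    have : p * a < p * q := Nat.mul_lt_mul_of_pos_left ha (by omega)
    omega
  refine hq (fun a => f^[p * a] y) (fun a b hab hb => ?_) fun a ha => ?_
  · have h1 := hbound a (by omega)
    have h2 := hbound b hb
    rw [hcmp _ _ (by omega) (by omega), hlt]
    refine Or.inr ⟨(hz _ _).2 (by simp), ?_⟩
    rw [tieBreak_mul hp2, tieBreak_mul hp2]
    exact_mod_cast hab
  · have h1 := hbound a (by omega)
    have h2 := hbound (a + 1) (by omega)
    have hzz : z (p * a + 1) = z (p * (a + 1) + 1) := (hz _ _).2 (by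
      rw [Nat.mul_add_mod, Nat.mul_add_mod])
    -- The images of the points `f^[p * a] y` are the iterates at times `p * a + 1`, the class with
    -- alternating tie-break.
    simp only [← Function.iterate_succ_apply' f]
    split_ifs with he
    · rw [hcmp _ _ (by omega) (by omega), hlt]
      refine Or.inr ⟨hzz.symm, ?_⟩
      rw [tieBreak_mul_add_one hp2, tieBreak_mul_add_one hp2, he.neg_one_pow,
        he.add_one.neg_one_pow]
      push_cast
      omega
    · rw [hcmp _ _ (by omega) (by omega), hlt]
      refine Or.inr ⟨hzz, ?_⟩
      have ho := Nat.not_even_iff_odd.1 he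
      rw [tieBreak_mul_add_one hp2, tieBreak_mul_add_one hp2, ho.neg_one_pow,
        ho.add_one.neg_one_pow]
      push_cast
      omega

/-! ### Large continuous periodic orbits -/

theorem continuousAt_iterate {X : Type*} [TopologicalSpace X] {f : X → X} {x : X} {n : ℕ}
    (h : ∀ k < n, ContinuousAt f (f^[k] x)) : ContinuousAt f^[n] x := by
  induction n with
  | zero => exact continuousAt_id
  | succ n ih =>
    rw [Function.iterate_succ']
    exact (h n (by omega)).comp (ih fun k hk => h k (by omega))

/-- Near a point with distinct iterates along which `f` is continuous, the order of the iterates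
does not change. -/
theorem exists_nhds_lt_iff_lt {X : Type*} [LinearOrder X] [TopologicalSpace X]
    [OrderClosedTopology X] {f : X → X} {x : X} {n : ℕ}
    (hcont : ∀ k < n, ContinuousAt f (f^[k] x))
    (hinj : ∀ i j, i ≤ n → j ≤ n → f^[i] x = f^[j] x → i = j) :
    ∃ U ∈ nhds x, ∀ y ∈ U, ∀ z ∈ U, ∀ i j, i ≤ n → j ≤ n → i ≠ j →
      (f^[i] y < f^[j] z ↔ f^[i] x < f^[j] x) := by
  have hc1 : ∀ i ≤ n, Filter.Tendsto (fun w : X × X => f^[i] w.1) (nhds x ×ˢ nhds x)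
      (nhds (f^[i] x)) := fun i hi =>
    Filter.Tendsto.comp (continuousAt_iterate fun k hk => hcont k (by omega)) Filter.tendsto_fst
  have hc2 : ∀ i ≤ n, Filter.Tendsto (fun w : X × X => f^[i] w.2) (nhds x ×ˢ nhds x)
      (nhds (f^[i] x)) := fun i hi =>
    Filter.Tendsto.comp (continuousAt_iterate fun k hk => hcont k (by omega)) Filter.tendsto_snd
  have hev : ∀ i ∈ Set.Iic n, ∀ j ∈ Set.Iic n, ∀ᶠ w : X × X in nhds x ×ˢ nhds x,
      i ≠ j → (f^[i] w.1 < f^[j] w.2 ↔ f^[i] x < f^[j] x) := fun i hi j hj => by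
    rcases lt_trichotomy (f^[i] x) (f^[j] x) with h | h | h
    · filter_upwards [(hc1 i hi).eventually_lt (hc2 j hj) h] with w hw _
      exact iff_of_true hw h
    · exact Filter.Eventually.of_forall fun w hne => absurd (hinj i j hi hj h) hne
    · filter_upwards [(hc2 j hj).eventually_lt (hc1 i hi) h] with w hw _
      exact iff_of_false hw.not_gt h.not_gt
  have := (Filter.eventually_all_finite (Set.finite_Iic n)).2 fun i hi =>
    (Filter.eventually_all_finite (Set.finite_Iic n)).2 fun j hj => hev i hi j hj
  obtain ⟨U, hU, h⟩ := Filter.eventually_prod_self_iff'.1 this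
  exact ⟨U, hU, fun y hy z hz i j hi hj hne => h y hy z hz i hi j hj hne⟩

theorem AlmostAperiodic.dense_aperiodicPts {f : unitInterval → unitInterval}
    (hf : AlmostAperiodic f) : Dense (aperiodicPts f) := by
  have hvol : (volume : Measure unitInterval).IsOpenPosMeasure := ⟨fun U hU hne => by
    obtain ⟨a, b, hab, hsub⟩ := hU.exists_Ioo_subset hne
    refine (lt_of_lt_of_le ?_ (measure_mono hsub)).ne'
    rw [unitInterval.volume_Ioo]
    simpa using hab⟩
  exact Measure.dense_of_ae hf

theorem HasLargeContinuousPeriodicOrbits.not_hasExclusionType {f : unitInterval → unitInterval}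
    (h : HasLargeContinuousPeriodicOrbits f) (hf : AlmostAperiodic f)
    (hmono : PiecewiseMonotone f) {n : ℕ} (hn : 1 ≤ n) : ¬ HasExclusionType f n := by
  obtain ⟨x, hx, hN, hcont⟩ := h (n + 1)
  have hz : ∀ i j, f^[i] x = f^[j] x ↔
      i % Function.minimalPeriod f x = j % Function.minimalPeriod f x := fun i j => by
    have hpos := Function.minimalPeriod_pos_of_mem_periodicPts hx
    rw [← Function.iterate_mod_minimalPeriod_eq, ← Function.iterate_mod_minimalPeriod_eq (n := j)]
    exact Function.iterate_eq_iterate_iff_of_lt_minimalPeriod (Nat.mod_lt _ hpos)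
      (Nat.mod_lt _ hpos)
  refine not_hasExclusionType_of_periodic hmono hn hN (fun i => f^[i] x) hz fun i => ?_
  obtain ⟨U, hU, hcmp⟩ := exists_nhds_lt_iff_lt (f := f) (x := f^[i] x) (n := n)
    (fun k _ => by rw [← Function.iterate_add_apply]; exact hcont _) fun a b ha hb hab => by
      rw [← Function.iterate_add_apply, ← Function.iterate_add_apply, hz] at hab
      exact (Nat.ModEq.add_right_cancel' i hab).eq_of_lt_of_lt (by omega) (by omega)
  obtain ⟨y, hyU, hy⟩ := mem_closure_iff_nhds.1 (hf.dense_aperiodicPts (f^[i] x)) U hU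
  refine order_mem_patterns hy fun a b => ?_
  rcases eq_or_ne a b with rfl | hne
  · simp
  rw [hcmp y hyU y hyU a b (by omega) (by omega) (Fin.val_injective.ne hne),
    ← Function.iterate_add_apply, ← Function.iterate_add_apply, add_comm i, add_comm i]

/-! ### Recurrent points -/

/-- The repeated block is `f^[n] x, …, f^[n + p - 1] x` with `f^[p] x` close to `x`. Starting at
time `n` lets a window that wraps around be pulled back to times at most `2 * n`, from `f^[p] x`
before the wrap and from `x` after it. Nearness of the two base points then gives it the same
pattern as a window of the orbit of `x`. -/
theorem not_hasExclusionType_of_recurrent {f : unitInterval → unitInterval}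
    (hmono : PiecewiseMonotone f) {n : ℕ} (hn : 1 ≤ n) {x : unitInterval}
    (hx : x ∈ aperiodicPts f) (hcont : ∀ k, ContinuousAt f (f^[k] x))
    (hrec : ∀ s ∈ nhds x, ∃ᶠ p in Filter.atTop, f^[p] x ∈ s) : ¬ HasExclusionType f n := by
  have hinj := iterate_injective hx
  obtain ⟨U, hU, hcmp⟩ := exists_nhds_lt_iff_lt (f := f) (x := x) (n := 2 * n)
    (fun k _ => hcont k) fun i j _ _ hij => hinj hij
  obtain ⟨p, hp, hpU⟩ := Filter.frequently_atTop.1 (hrec U hU) (n + 1)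
  have hxU := mem_of_mem_nhds hU
  refine not_hasExclusionType_of_periodic hmono hn hp (fun i => f^[n + i % p] x)
    (fun i j => ⟨fun h => Nat.add_left_cancel (hinj h), fun h => by simp only [h]⟩) fun i => ?_
  have hr : i % p < p := Nat.mod_lt _ (by omega)
  rcases lt_or_ge (i % p + n) p with hlt | hge
  · refine order_mem_patterns (iterate_mem_aperiodicPts hx (n + i % p)) fun a b => ?_
    have hmod : ∀ a : Fin (n + 1), (i + a) % p = i % p + a := fun a => by
      rw [Nat.add_mod, Nat.mod_eq_of_lt (show (a : ℕ) < p by omega), Nat.mod_eq_of_lt (by omega)]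
    rw [hmod, hmod, ← Function.iterate_add_apply, ← Function.iterate_add_apply,
      show (a : ℕ) + (n + i % p) = n + (i % p + a) by omega,
      show (b : ℕ) + (n + i % p) = n + (i % p + b) by omega]
  -- Here `s + 1` is the number of entries before the wrap; it is at most `n`, so `n - (s + 1)` is
  -- not truncated.
  · obtain ⟨s, hs⟩ := Nat.exists_eq_add_of_lt hr
    have hval : ∀ a : Fin (n + 1), f^[n + (i + a) % p] x =
        f^[a + (n - (s + 1))] (if (a : ℕ) < s + 1 then f^[p] x else x) := fun a => by
      rw [Nat.add_mod, Nat.mod_eq_of_lt (show (a : ℕ) < p by omega)]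
      split_ifs with ha
      · rw [Nat.mod_eq_of_lt (by omega), ← Function.iterate_add_apply]
        congr 1
        omega
      · rw [Nat.mod_eq_sub_mod (by omega), Nat.mod_eq_of_lt (by omega)]
        congr 1
        omega
    have hmem : ∀ a : Fin (n + 1), (if (a : ℕ) < s + 1 then f^[p] x else x) ∈ U := fun a => by
      split_ifs
      · exact hpU
      · exact hxU
    refine order_mem_patterns (iterate_mem_aperiodicPts hx (n - (s + 1))) fun a b => ?_
    rcases eq_or_ne a b with rfl | hne
    · simp
    have hne' := Fin.val_injective.ne hne
    rw [hval, hval, hcmp _ (hmem a) _ (hmem b) _ _ (by omega) (by omega) (by omega),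
      Function.iterate_add_apply, Function.iterate_add_apply]

/-- A point of a piece that is neither its least nor its greatest element is interior to it, so
discontinuities occur only at attained endpoints. -/
theorem PiecewiseContinuous.finite_not_continuousAt {f : unitInterval → unitInterval}
    (hf : PiecewiseContinuous f) : {x | ¬ ContinuousAt f x}.Finite := by
  obtain ⟨P, hP, hPJ⟩ := hf
  have hsub : {x | ¬ ContinuousAt f x} ⊆ ⋃ J ∈ P, ({x | IsLeast J x} ∪ {x | IsGreatest J x}) := by
    intro x hx
    have hxP : x ∈ ⋃ J ∈ P, J := hP ▸ Set.mem_univ _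
    simp only [Set.mem_iUnion] at hxP ⊢
    obtain ⟨J, hJP, hxJ⟩ := hxP
    refine ⟨J, hJP, ?_⟩
    by_contra hne
    simp only [Set.mem_union, Set.mem_ofPred_eq, IsLeast, IsGreatest, hxJ, true_and, mem_lowerBounds,
      mem_upperBounds, not_or, not_forall, not_le] at hne
    obtain ⟨⟨a, ha, hax⟩, ⟨b, hb, hxb⟩⟩ := hne
    exact hx ((hPJ J hJP).2.continuousAt
      (Filter.mem_of_superset (Icc_mem_nhds hax hxb) ((hPJ J hJP).1.out ha hb)))
  refine (P.finite_toSet.biUnion fun J _ => Set.Finite.union ?_ ?_).subset hsub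
  · exact Set.Subsingleton.finite fun a ha b hb => ha.unique hb
  · exact Set.Subsingleton.finite fun a ha b hb => ha.unique hb

theorem exists_recurrent {f : unitInterval → unitInterval} (h : ErgodicOnSubinterval f)
    (hf : AlmostAperiodic f) (hcont : PiecewiseContinuous f) :
    ∃ x ∈ aperiodicPts f, (∀ k, ContinuousAt f (f^[k] x)) ∧
      ∀ s ∈ nhds x, ∃ᶠ p in Filter.atTop, f^[p] x ∈ s := by
  obtain ⟨J, hJ, ⟨a, ha, b, hb, hab⟩, herg⟩ := h
  wlog hlt : a < b generalizing a b
  · exact this b hb a ha hab.symm (lt_of_le_of_ne (not_lt.1 hlt) hab.symm)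
  have hmp := herg.toMeasurePreserving
  have hpos : (volume : Measure unitInterval) J ≠ 0 := by
    refine (lt_of_lt_of_le ?_ (measure_mono (hJ.out ha hb))).ne'
    rw [unitInterval.volume_Icc]
    simpa using hlt
  have hne : (ae ((volume : Measure unitInterval).restrict J)).NeBot := by
    rw [ae_neBot]
    simpa using hpos
  have h1 : ∀ᵐ x ∂(volume : Measure unitInterval).restrict J, x ∈ aperiodicPts f :=
    ae_restrict_of_ae hf
  have h0 : ∀ᵐ x ∂(volume : Measure unitInterval).restrict J, ContinuousAt f x :=
    ae_restrict_of_ae (hcont.finite_not_continuousAt.measure_zero _)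
  have h2 : ∀ᵐ x ∂(volume : Measure unitInterval).restrict J, ∀ k, ContinuousAt f (f^[k] x) :=
    ae_all_iff.2 fun k => (hmp.iterate k).quasiMeasurePreserving.ae h0
  -- Poincaré recurrence: a map preserving a finite measure is conservative.
  have h3 := hmp.conservative.ae_frequently_mem_of_mem_nhds
  obtain ⟨x, hx1, hx2, hx3⟩ := (h1.and (h2.and h3)).exists
  exact ⟨x, hx1, hx2, hx3⟩

end OrderPattern

theorem corollary6 (f : unitInterval → unitInterval)
    (hf : OrderPattern.AlmostAperiodic f)
    (hcont : OrderPattern.PiecewiseContinuous f)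
    (hmono : OrderPattern.PiecewiseMonotone f)
    (h : OrderPattern.ErgodicOnSubinterval f ∨
      OrderPattern.HasLargeContinuousPeriodicOrbits f) :
    ¬ OrderPattern.HasFiniteExclusionType f := by
  rintro ⟨n, hn, hex⟩
  rcases h with h | h
  · obtain ⟨x, hx, hc, hrec⟩ := OrderPattern.exists_recurrent h hf hcont
    exact OrderPattern.not_hasExclusionType_of_recurrent hmono hn hx hc hrec hex
  · exact h.not_hasExclusionType hf hmono hn hex
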